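/- Let $F$ (firms), $W$ (workers) and $X$ (contracts) be finite sets with $|F|,|W|\ge 2$; each contract $x\in X$ is signed by one firm $x_F$ and one worker $x_W$. Put $N=F\sqcup W$ and $n=|N|$. For $Y\subseteq X$ let $Y_w$ be the set of contracts in $Y$ signed by $w$, and let $F(Y)$, $W(Y)$ and $N(Y)=F(Y)\cup W(Y)$ be the sets of firms, workers and agents who have a contract in $Y$. The assignments of a firm $f$ are the sets of contracts of $f$ containing at most one contract for each worker; the assignments of a worker $w$ are $\emptyset$ and the singletons $\{x\}$ with $x_W=w$. Every agent $i$ has a complete, transitive and strict preference $\succ_i$ over its assignments, and $\{x\}\succ_{x_W}\emptyset$ for every $x\in X$. An assignment $Y$ of $f$ is acceptable for $f$ if $Y\succ_f\emptyset$; let $\overline{\mathcal A}^F$ be the set of acceptable assignments of all firms. For a worker $w$ and sets $Y,Z$, each of which is empty or an assignment of some firm involving $w$, write $Y\rhd_w Z$ if $Y_w\succ_w Z_w$, or if $Y_w=Z_w$ and $Y\succ_f Z$ where $F(Y)=F(Z)=\{f\}$. Let $\pi$ be a scheme: vectors $\pi_Y\in\mathbb R^N_+$ for $Y\in\overline{\mathcal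 A}^F$ with $\pi_Y(i)>0$ exactly for $i\in N(Y)$, and $\pi_N\in\mathbb R^N$ with all components positive. A $\pi$-schedule matching is a vector $t\ge 0$ indexed by $\overline{\mathcal A}^F$ with $\sum_Y t(Y)\pi_Y(i)\le\pi_N(i)$ for all $i\in N$; agent $i$ is full matched if equality holds. The worst situation $\tilde t(i)$ of an agent $i$ is $\emptyset$ if $i$ is not full matched, and otherwise the least $Y\in\overline{\mathcal A}^F$ with $t(Y)>0$ and $i\in N(Y)$, with respect to $\succ_i$ if $i$ is a firm and to $\rhd_i$ if $i$ is a worker. An acceptable assignment $Z$ of a firm $f$ blocks $t$ if $Z\succ_f\tilde t(f)$ and $Z\rhd_w\tilde t(w)$ for all $w\in W(Z)$; $t$ is stable if nothing blocks it. Let $A$ be the matrix with rows $N$ and columns $N\sqcup\overline{\mathcal A}^F$ whose column $j\in N$ is the unit vector of $j$ and whose column $Y$ is $\pi_Y$. Let $C=(c_{ij})$ be a real matrix of the same shape such that: $c_{ii}=0$ for $i\in N$ and all other entries are positive; $c_{fY}>c_{fZ}$ if $Y,Z$ are acceptable for the firm $f$ and $Y\succ_f Z$; $c_{wY}>c_{wZ}$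 if $w\in W(Y)\cap W(Z)$ and $Y\rhd_w Z$; all $c_{ij}$ with $i\ne j$ in $N$ and all $c_{kY}$ with $k\notin N(Y)$ are larger than every $c_{lZ}$ with $l\in N(Z)$; the entries in each row are distinct; and $c_{ij}>c_{iY}$ for all $Y$ and all $i\ne j$ in $N$. Assume that the polytope $\{b\ge 0: Ab=\pi_N\}$ is nondegenerate: in every basic feasible solution all $n$ components of the corresponding basis are positive. A set $O$ of $n$ columns is an ordinal basis of $C$ if for every column $s$ there is a row $i$ with $c_{is}\le\min_{k\in O}c_{ik}$. A pivot step replaces a column of a feasible basis by a given column outside it so that a feasible basis results. An ordinal pivot step removes a given column $k$ from an ordinal basis $O$ and brings in a column outside $O$ as follows: let $m$ be the column of $R=O\setminus\{k\}$ that contains two row minimizers of $R$, one of them new and the other, in row $i^*$, already a row minimizer of $O$; among the columns $s$ with $c_{is}>\min_{r\in R}c_{ir}$ for all rows $i\ne i^*$, the one that maximizes $c_{i^*s}$ is brought in. Scarf's algorithm chooses a row and starts with the feasible basis $A^0=N$, the collection $C^0$ of the $n$ columns with the largest components in that row, and the column $j_0$ with $\{j_0\}=C^0\setminus A^0$ (if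 $C^0=A^0$, i.e. if $\overline{\mathcal A}^F=\emptyset$, it terminates at once). In step $s\ge1$, a pivot step brings $j_{s-1}$ into the $A$ basis; the algorithm terminates if the two bases coincide; otherwise an ordinal pivot step removes from the $C$ basis the column that has just left the $A$ basis and brings in a column $j_s$; the algorithm terminates if the two bases coincide, and otherwise proceeds to the next step. **Theorem.** For every such $C$ and every choice of the initial row, the algorithm is well defined: the initialization is unique, the $A$ bases and $C$ bases it produces are feasible bases and ordinal bases, respectively, and each pivot step and ordinal pivot step it calls for can be carried out in exactly one way. The algorithm never cycles (no pair consisting of an $A$ basis and a $C$ basis occurs twice) and it terminates. At termination the two bases are the same set of columns, which is both a feasible basis and an ordinal basis, and if $b$ is its (unique, nonnegative) basic solution of $Ab=\pi_N$, then $(b(Y))_{Y\in\overline{\mathcal A}^F}$ is a stable $\pi$-schedule matching. -/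

import Mathlib

/-! ### Many-to-one matching markets -/

/-- `Y` is an assignment of the firm `f`: a set of contracts of `f` with at most one contract for
each worker. -/
def IsFirmAssignment {F W X : Type*} [DecidableEq W] (firm : X → F) (worker : X → W) (f : F)
    (Y : Finset X) : Prop :=
  (∀ x ∈ Y, firm x = f) ∧ ∀ w, (Y.filter fun x => worker x = w).card ≤ 1

/-- `Y` is an assignment of the worker `w`: empty, or a single contract of `w`. -/
def IsWorkerAssignment {W X : Type*} (worker : X → W) (w : W) (Y : Finset X) : Prop :=
  Y = ∅ ∨ ∃ x, worker x = w ∧ Y = {x}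

/-- A many-to-one matching market with firms `F`, workers `W` and contracts `X`. The relation
`firmPref f Y Z` is read `Y ≻_f Z` and matters only on the assignments of `f`; the relation
`workerPref w Y Z` is read `Y ≻_w Z` and matters only on the assignments of `w`. -/
structure Market (F W X : Type*) [DecidableEq W] where
  firm : X → F
  worker : X → W
  firmPref : F → Finset X → Finset X → Prop
  workerPref : W → Finset X → Finset X → Prop
  /-- The preference of a firm over its assignments is complete, transitive and strict. -/
  firmPref_strict : ∀ f, IsStrictTotalOrder {Y // IsFirmAssignment firm worker f Y}
    fun Y Z => firmPref f Y.1 Z.1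
  /-- The preference of a worker over her assignments is complete, transitive and strict. -/
  workerPref_strict : ∀ w, IsStrictTotalOrder {Y // IsWorkerAssignment worker w Y}
    fun Y Z => workerPref w Y.1 Z.1
  /-- Every contract is acceptable for the worker who signs it. -/
  workerPref_empty : ∀ x, workerPref (worker x) {x} ∅

namespace Market

variable {F W X : Type*} [DecidableEq F] [DecidableEq W] [DecidableEq X] (M : Market F W X)

/-- `Y_w`: the contracts in `Y` signed by the worker `w`. -/
def ofWorker (Y : Finset X) (w : W) : Finset X := Y.filter fun x => M.worker x = w

/-- `F(Y)`: the firms that have contracts in `Y`. -/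
def firms (Y : Finset X) : Finset F := Y.image M.firm

/-- `W(Y)`: the workers who have contracts in `Y`. -/
def workers (Y : Finset X) : Finset W := Y.image M.worker

/-- `N(Y) = F(Y) ∪ W(Y)`: the agents who have contracts in `Y`. The set of agents is the disjoint
union `F ⊕ W`. -/
def agents (Y : Finset X) : Finset (F ⊕ W) := (M.firms Y).disjSum (M.workers Y)

/-- `Y` is an acceptable assignment of the firm `f` (such a `Y` is nonempty). -/
def IsAcceptable (f : F) (Y : Finset X) : Prop :=
  IsFirmAssignment M.firm M.worker f Y ∧ M.firmPref f Y ∅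

/-- The set of all acceptable assignments of all firms. -/
abbrev Acceptable : Type _ := {Y : Finset X // ∃ f, M.IsAcceptable f Y}

noncomputable instance [Fintype X] : Fintype M.Acceptable := Fintype.ofFinite _

/-- Worker `w`'s preference `Y ▷_w Z` over situations (sets `Y`, `Z` which are empty or an
assignment of some firm involving `w`), with the artificial externality: ties in `w`'s own contract
are broken by the preference of the employer. -/
def sitPref (w : W) (Y Z : Finset X) : Prop :=
  M.workerPref w (M.ofWorker Y w) (M.ofWorker Z w) ∨
    (M.ofWorker Y w = M.ofWorker Z w ∧
      ∃ f, M.firms Y = {f} ∧ M.firms Z = {f} ∧ M.firmPref f Y Z)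

/-- A scheme `π`: `rate Y` is the vector `π_Y` and `cap` is the vector `π_N`. -/
structure Scheme where
  rate : M.Acceptable → F ⊕ W → ℝ
  cap : F ⊕ W → ℝ
  rate_pos : ∀ Y : M.Acceptable, ∀ i ∈ M.agents Y.1, 0 < rate Y i
  rate_zero : ∀ Y : M.Acceptable, ∀ i ∉ M.agents Y.1, rate Y i = 0
  cap_pos : ∀ i, 0 < cap i

variable {M} [Fintype X]

/-- `t` is a `π`-schedule matching. -/
def Scheme.IsScheduleMatching (π : M.Scheme) (t : M.Acceptable → ℝ) : Prop :=
  (∀ Y, 0 ≤ t Y) ∧ ∀ i, ∑ Y, t Y * π.rate Y i ≤ π.cap i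

/-- The agent `i` is full matched in `t`. -/
def Scheme.FullMatched (π : M.Scheme) (t : M.Acceptable → ℝ) (i : F ⊕ W) : Prop :=
  ∑ Y, t Y * π.rate Y i = π.cap i

/-- `V` is the worst situation of the firm `f` in `t`: the `≻_f`-least acceptable assignment of `f`
with a positive time share if `f` is full matched, and `∅` otherwise. -/
def Scheme.IsWorstFirm (π : M.Scheme) (t : M.Acceptable → ℝ) (f : F) (V : Finset X) : Prop :=
  (π.FullMatched t (Sum.inl f) ∧
    (∃ Y : M.Acceptable, Y.1 = V ∧ M.IsAcceptable f Y.1 ∧ 0 < t Y) ∧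
    ∀ Y : M.Acceptable, M.IsAcceptable f Y.1 → 0 < t Y → M.firmPref f Y.1 V ∨ Y.1 = V) ∨
  (¬ π.FullMatched t (Sum.inl f) ∧ V = ∅)

/-- `V` is the worst situation of the worker `w` in `t`: the `▷_w`-least acceptable assignment of a
firm that involves `w` and has a positive time share if `w` is full matched, and `∅` otherwise. -/
def Scheme.IsWorstWorker (π : M.Scheme) (t : M.Acceptable → ℝ) (w : W) (V : Finset X) : Prop :=
  (π.FullMatched t (Sum.inr w) ∧
    (∃ Y : M.Acceptable, Y.1 = V ∧ w ∈ M.workers Y.1 ∧ 0 < t Y) ∧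
    ∀ Y : M.Acceptable, w ∈ M.workers Y.1 → 0 < t Y → M.sitPref w Y.1 V ∨ Y.1 = V) ∨
  (¬ π.FullMatched t (Sum.inr w) ∧ V = ∅)

/-- The acceptable assignment `Z` of the firm `f` blocks `t`: the firm and every worker in `W(Z)`
strictly prefer `Z` to their worst situation in `t`. -/
def Scheme.Blocks (π : M.Scheme) (t : M.Acceptable → ℝ) (f : F) (Z : Finset X) : Prop :=
  M.IsAcceptable f Z ∧
    (∃ V, π.IsWorstFirm t f V ∧ M.firmPref f Z V) ∧
    ∀ w ∈ M.workers Z, ∃ V, π.IsWorstWorker t w V ∧ M.sitPref w Z V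

/-- `t` is a stable `π`-schedule matching. -/
def Scheme.IsStableScheduleMatching (π : M.Scheme) (t : M.Acceptable → ℝ) : Prop :=
  π.IsScheduleMatching t ∧ ∀ f Z, ¬ π.Blocks t f Z

variable (M) in
/-- The index set of the columns of both matrices: all agents, then all acceptable assignments. -/
abbrev Column : Type _ := (F ⊕ W) ⊕ M.Acceptable

/-- The matrix `A`: unit columns for the agents, column `π_Y` for every acceptable `Y`. -/
def Scheme.matrix (π : M.Scheme) : Matrix (F ⊕ W) M.Column ℝ :=
  Matrix.fromCols 1 (Matrix.of fun i Y => π.rate Y i)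

/-- The requirements on the matrix `C` of utilities with artificial externalities. -/
structure IsUtilityMatrix (M : Market F W X) (C : Matrix (F ⊕ W) M.Column ℝ) : Prop where
  diag : ∀ i, C i (Sum.inl i) = 0
  pos : ∀ i j, j ≠ Sum.inl i → 0 < C i j
  firm : ∀ (f : F) (Y Z : M.Acceptable), M.IsAcceptable f Y.1 → M.IsAcceptable f Z.1 →
    M.firmPref f Y.1 Z.1 → C (Sum.inl f) (Sum.inr Z) < C (Sum.inl f) (Sum.inr Y)
  worker : ∀ (w : W) (Y Z : M.Acceptable), w ∈ M.workers Y.1 → w ∈ M.workers Z.1 →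
    M.sitPref w Y.1 Z.1 → C (Sum.inr w) (Sum.inr Z) < C (Sum.inr w) (Sum.inr Y)
  large_agent : ∀ (i j k : F ⊕ W) (Y : M.Acceptable), i ≠ j → k ∈ M.agents Y.1 →
    C k (Sum.inr Y) < C i (Sum.inl j)
  large_assignment : ∀ (i k : F ⊕ W) (Y Z : M.Acceptable), i ∉ M.agents Z.1 →
    k ∈ M.agents Y.1 → C k (Sum.inr Y) < C i (Sum.inr Z)
  row_injective : ∀ i, Function.Injective (C i)
  offdiag : ∀ (i j : F ⊕ W) (Y : M.Acceptable), i ≠ j → C i (Sum.inr Y) < C i (Sum.inl j)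

end Market

/-! ### Cardinal and ordinal pivot steps -/

section Pivot

variable {ι κ : Type*} [Fintype ι] [Fintype κ] [DecidableEq κ]

/-- The columns in `B` form a basis of the matrix `A`: there are as many of them as rows, and they
are linearly independent. -/
def IsColumnBasis (A : Matrix ι κ ℝ) (B : Finset κ) : Prop :=
  B.card = Fintype.card ι ∧ LinearIndependent ℝ fun j : B => fun i => A i j

/-- `b` is the basic solution of `A b = q` for the basis `B`. -/
def IsBasicSolution (A : Matrix ι κ ℝ) (q : ι → ℝ) (B : Finset κ) (b : κ → ℝ) : Prop :=
  A.mulVec b = q ∧ ∀ j ∉ B, b j = 0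

/-- `B` is a feasible basis of the polytope `{b | b ≥ 0, A b = q}`. -/
def IsFeasibleBasis (A : Matrix ι κ ℝ) (q : ι → ℝ) (B : Finset κ) : Prop :=
  IsColumnBasis A B ∧ ∃ b, IsBasicSolution A q B b ∧ ∀ j, 0 ≤ b j

/-- The polytope `{b | b ≥ 0, A b = q}` is nondegenerate: in every basic feasible solution all
components that belong to the corresponding basis are positive. -/
def IsNondegenerate (A : Matrix ι κ ℝ) (q : ι → ℝ) : Prop :=
  ∀ B b, IsColumnBasis A B → IsBasicSolution A q B b → (∀ j, 0 ≤ b j) → ∀ j ∈ B, 0 < b j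

/-- A (cardinal) pivot step: from the feasible basis `B`, bring in the column `j` and remove the
column `k`, which gives the feasible basis `B₁`. -/
def IsPivotStep (A : Matrix ι κ ℝ) (q : ι → ℝ) (B : Finset κ) (j k : κ) (B₁ : Finset κ) : Prop :=
  IsFeasibleBasis A q B ∧ j ∉ B ∧ k ∈ B ∧ B₁ = insert j (B.erase k) ∧ IsFeasibleBasis A q B₁

/-- `O` is an ordinal basis of `C`: it consists of `n` columns, and with `u i` the least entry of
row `i` in these columns, every column `s` has an entry `C i s ≤ u i`. -/
def IsOrdinalBasis (C : Matrix ι κ ℝ) (O : Finset κ) : Prop :=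
  O.card = Fintype.card ι ∧ ∀ s, ∃ i, ∀ k ∈ O, C i s ≤ C i k

/-- The column `k` of the collection `R` is the minimizer of row `i` over `R`. -/
def IsRowMinimizer (C : Matrix ι κ ℝ) (R : Finset κ) (i : ι) (k : κ) : Prop :=
  k ∈ R ∧ ∀ s ∈ R, C i k ≤ C i s

/-- `C i k > min {C i s | s ∈ R}` for all rows `i` other than `r`. -/
def IsCandidate (C : Matrix ι κ ℝ) (R : Finset κ) (r : ι) (k : κ) : Prop :=
  ∀ i, i ≠ r → ∃ s ∈ R, C i s < C i k

/-- An ordinal pivot step: from the ordinal basis `O`, remove the column `k` and bring in the column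
`j`, which gives `O₁`. Here `m` is the remaining column that contains two row minimizers of the
remaining columns, one of them (row `r₁`) new and the other (row `r`) a row minimizer for the
original basis; `j` is the candidate for `r` that maximizes the entry in row `r`. -/
def IsOrdinalPivotStep (C : Matrix ι κ ℝ) (O : Finset κ) (k j : κ) (O₁ : Finset κ) : Prop :=
  IsOrdinalBasis C O ∧ k ∈ O ∧
    ∃ (m : κ) (r r₁ : ι),
      IsRowMinimizer C (O.erase k) r₁ m ∧ ¬ IsRowMinimizer C O r₁ m ∧
      IsRowMinimizer C (O.erase k) r m ∧ IsRowMinimizer C O r m ∧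
      j ∉ O ∧ IsCandidate C (O.erase k) r j ∧
      (∀ s, IsCandidate C (O.erase k) r s → C r s ≤ C r j) ∧
      O₁ = insert j (O.erase k)

/-- `O` consists of the columns with the largest `n` components in row `i`. -/
def IsTopColumns (C : Matrix ι κ ℝ) (i : ι) (O : Finset κ) : Prop :=
  O.card = Fintype.card ι ∧ ∀ k ∈ O, ∀ s ∉ O, C i s < C i k

end Pivot

/-! ### Scarf's algorithm -/

/-- A state of Scarf's algorithm, always with the current `A` basis and the current `C` basis:
`cardinal B O j` if the next operation is a pivot step bringing the column `j` into the `A` basis;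
`ordinal B O k` if it is an ordinal pivot step removing the column `k` from the `C` basis;
`terminated B O` if the algorithm has terminated. -/
inductive ScarfState (κ : Type*) where
  | cardinal (B O : Finset κ) (j : κ)
  | ordinal (B O : Finset κ) (k : κ)
  | terminated (B O : Finset κ)

namespace ScarfState

variable {κ : Type*}

/-- The current `A` basis. -/
def basisA : ScarfState κ → Finset κ
  | cardinal B _ _ => B
  | ordinal B _ _ => B
  | terminated B _ => B

/-- The current `C` basis. -/
def basisC : ScarfState κ → Finset κ
  | cardinal _ O _ => O
  | ordinal _ O _ => O
  | terminated _ O => O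

/-- The algorithm has terminated. -/
def IsTerminated : ScarfState κ → Prop
  | cardinal _ _ _ => False
  | ordinal _ _ _ => False
  | terminated _ _ => True

end ScarfState

/-- Step 0, with the columns indexed by the rows `ι` and by further indices `α`. The first `A` basis
consists of the first `n` columns, the first `C` basis of the `n` columns with the largest
components in row `i`, and the first column to be brought into the `A` basis is the one in the `C`
basis but not in the `A` basis. If the two bases coincide (which happens only when there are no
columns beyond the first `n`), there is nothing to do. -/
inductive ScarfInit {ι α : Type*} [Fintype ι] [DecidableEq ι] [DecidableEq α]
    (C : Matrix ι (ι ⊕ α) ℝ) (i : ι) : ScarfState (ι ⊕ α) → Prop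
  | start (B O : Finset (ι ⊕ α)) (j : ι ⊕ α) (hB : B = Finset.univ.image Sum.inl)
      (hO : IsTopColumns C i O) (hj : O \ B = {j}) : ScarfInit C i (.cardinal B O j)
  | trivial (B O : Finset (ι ⊕ α)) (hB : B = Finset.univ.image Sum.inl)
      (hO : IsTopColumns C i O) (h : B = O) : ScarfInit C i (.terminated B O)

/-- One operation (half a step) of Scarf's algorithm: a pivot step that brings in the prescribed
column, or an ordinal pivot step that removes the column that has just left the `A` basis; after
each of them the algorithm terminates if and only if the two bases coincide. -/
inductive ScarfStep {ι κ : Type*} [Fintype ι] [Fintype κ] [DecidableEq κ]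
    (A : Matrix ι κ ℝ) (q : ι → ℝ) (C : Matrix ι κ ℝ) : ScarfState κ → ScarfState κ → Prop
  | cardinal_terminate (B O B₁ : Finset κ) (j k : κ) (h : IsPivotStep A q B j k B₁)
      (hEq : B₁ = O) : ScarfStep A q C (.cardinal B O j) (.terminated B₁ O)
  | cardinal_continue (B O B₁ : Finset κ) (j k : κ) (h : IsPivotStep A q B j k B₁)
      (hNe : B₁ ≠ O) : ScarfStep A q C (.cardinal B O j) (.ordinal B₁ O k)
  | ordinal_terminate (B O O₁ : Finset κ) (k j : κ) (h : IsOrdinalPivotStep C O k j O₁)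
      (hEq : O₁ = B) : ScarfStep A q C (.ordinal B O k) (.terminated B O₁)
  | ordinal_continue (B O O₁ : Finset κ) (k j : κ) (h : IsOrdinalPivotStep C O k j O₁)
      (hNe : O₁ ≠ B) : ScarfStep A q C (.ordinal B O k) (.cardinal B O₁ j)

/-! The proof is a path-following argument. Let `i` be the initial row. A live state is a feasible
basis `B` and an ordinal basis `O` with `B \ O = {.inl i}`, together with a direction: either the
single column of `O \ B` is about to enter `B`, or it is about to leave `O`. Flipping the direction
(`ScarfState.rev`) turns every step into a step backwards, because both kinds of pivot are
deterministic and reversible. Nondegeneracy gives this for `A` and distinct row entries give it for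
`C`. So the pairs of bases form a graph with at most two moves at each vertex.

The starting pair is an end of its path: its other move would leave only agent columns in `O`, and
no column can then enter (`not_isOrdinalPivotStep`). Every live state other than the reverse of the
start can move on (`exists_scarfStep`). A path that begins at an end never closes up
(`not_transGen_self`). It cannot reach the reverse of one of its own states either, since the path
between them would be a palindrome with an impossible middle (`not_reflTransGen_rev`). By finiteness
the run stops, and it can stop only where `B = O`.

At such a basis, the ordinal property gives, for any acceptable `Z`, a row in which the entry of `Z`
is at most that of every basis column. The zero diagonal and the large entries of `C` force the
agent of that row to be full matched and to belong to `Z`. This agent then does not prefer `Z` to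
its worst situation, so `Z` does not block (`isStable_of_basis`). -/

set_option linter.unusedSectionVars false

/-! ### Cardinal pivoting: the exchange of columns in feasible bases. -/

section Cardinal

variable {ι κ : Type*} [Fintype ι] [Fintype κ] [DecidableEq κ] {A : Matrix ι κ ℝ} {q : ι → ℝ}
  {B B₁ B₂ : Finset κ}

lemma mulVec_eq_sum_of_support (v : κ → ℝ) (hv : ∀ j ∉ B, v j = 0) :
    A.mulVec v = ∑ j : B, v j • fun i => A i j := by
  ext i
  rw [Matrix.mulVec, dotProduct, Finset.sum_apply]
  simp only [Pi.smul_apply, smul_eq_mul]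
  rw [Finset.sum_coe_sort B (fun j => v j * A i j)]
  rw [← Finset.sum_subset (Finset.subset_univ B)]
  · exact Finset.sum_congr rfl fun j _ => mul_comm _ _
  · intro j _ hj
    rw [hv j hj, mul_zero]

lemma IsColumnBasis.eq_zero (hB : IsColumnBasis A B) {v : κ → ℝ} (hv : ∀ j ∉ B, v j = 0)
    (h : A.mulVec v = 0) : v = 0 := by
  rw [mulVec_eq_sum_of_support v hv] at h
  have := Fintype.linearIndependent_iff.1 hB.2 (fun j => v j) h
  ext j
  by_cases hj : j ∈ B
  · exact this ⟨j, hj⟩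
  · exact hv j hj

lemma isColumnBasis_of_eq_zero (hc : B.card = Fintype.card ι)
    (h : ∀ v : κ → ℝ, (∀ j ∉ B, v j = 0) → A.mulVec v = 0 → v = 0) : IsColumnBasis A B := by
  refine ⟨hc, Fintype.linearIndependent_iff.2 fun g hg j => ?_⟩
  have hs : ∀ j ∉ B, (fun j => if hj : j ∈ B then g ⟨j, hj⟩ else 0) j = 0 := fun j hj => by
    simp [hj]
  have := h _ hs (by
    rw [mulVec_eq_sum_of_support _ hs, ← hg]
    exact Finset.sum_congr rfl fun j _ => by simp)
  simpa using congrFun this j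

lemma IsColumnBasis.exists_mulVec_eq (hB : IsColumnBasis A B) (w : ι → ℝ) :
    ∃ v : κ → ℝ, (∀ j ∉ B, v j = 0) ∧ A.mulVec v = w := by
  have hspan : ⊤ ≤ Submodule.span ℝ (Set.range fun j : B => fun i => A i j) := by
    rw [hB.2.span_eq_top_of_card_eq_finrank' (by simp [hB.1])]
  obtain ⟨g, hg⟩ := (Submodule.mem_span_range_iff_exists_fun ℝ).1 (hspan (Submodule.mem_top (x := w)))
  have hs : ∀ j ∉ B, (fun j => if hj : j ∈ B then g ⟨j, hj⟩ else 0) j = 0 := fun j hj => by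
    simp [hj]
  refine ⟨_, hs, ?_⟩
  rw [mulVec_eq_sum_of_support _ hs, ← hg]
  exact Finset.sum_congr rfl fun j _ => by simp

lemma IsColumnBasis.basicSolution_unique (hB : IsColumnBasis A B) {b b' : κ → ℝ}
    (h : IsBasicSolution A q B b) (h' : IsBasicSolution A q B b') : b = b' := by
  refine sub_eq_zero.1 (hB.eq_zero (fun j hj => ?_) ?_)
  · simp [h.2 j hj, h'.2 j hj]
  · rw [Matrix.mulVec_sub, h.1, h'.1, sub_self]

/-- The direction in which the basic solution moves when the column `j` is brought in. -/
lemma IsColumnBasis.exists_direction (hB : IsColumnBasis A B) {j : κ} (hj : j ∉ B) :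
    ∃ d : κ → ℝ, d j = 1 ∧ (∀ l ∉ insert j B, d l = 0) ∧ A.mulVec d = 0 := by
  obtain ⟨v, hv, hAv⟩ := hB.exists_mulVec_eq (A.mulVec (Pi.single j 1))
  refine ⟨Pi.single j 1 - v, by simp [hv j hj], fun l hl => ?_, ?_⟩
  · rw [Finset.mem_insert, not_or] at hl
    simp [hv l hl.2, Pi.single_eq_of_ne hl.1]
  · rw [Matrix.mulVec_sub, hAv, sub_self]

/-- A vector in the kernel supported in `insert j B` is determined by its component `j`. -/
lemma IsColumnBasis.eq_smul_direction (hB : IsColumnBasis A B) {j : κ} {d v : κ → ℝ}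
    (hd : d j = 1) (hd0 : ∀ l ∉ insert j B, d l = 0) (hAd : A.mulVec d = 0)
    (hv0 : ∀ l ∉ insert j B, v l = 0) (hAv : A.mulVec v = 0) : v = v j • d := by
  refine sub_eq_zero.1 (hB.eq_zero (fun l hl => ?_) ?_)
  · by_cases h : l = j
    · subst h; simp [hd]
    · have : l ∉ insert j B := by simp [h, hl]
      simp [hd0 l this, hv0 l this]
  · rw [Matrix.mulVec_sub, Matrix.mulVec_smul, hAd, hAv, smul_zero, sub_self]

/-- The ratio test of the simplex method: starting at `b`, move along the direction `d` until the
first component vanishes. Since `hbdd` excludes nonzero nonnegative kernel vectors, some component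
of `d` is negative, so the movement is stopped. -/
lemma exists_pivotStep (hnd : IsNondegenerate A q)
    (hbdd : ∀ d : κ → ℝ, (∀ j, 0 ≤ d j) → A.mulVec d = 0 → d = 0)
    (hB : IsFeasibleBasis A q B) {j : κ} (hj : j ∉ B) : ∃ k B₁, IsPivotStep A q B j k B₁ := by
  obtain ⟨hbas, b, hb, hb0⟩ := id hB
  obtain ⟨d, hdj, hd0, hAd⟩ := hbas.exists_direction hj
  have hbpos := hnd B b hbas hb hb0
  have hneg : ((B.filter fun l => d l < 0)).Nonempty := by
    by_contra hne
    rw [Finset.not_nonempty_iff_eq_empty, Finset.filter_eq_empty_iff] at hne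
    have : d = 0 := hbdd d (fun l => by
      by_cases hl : l ∈ insert j B
      · rcases Finset.mem_insert.1 hl with rfl | hl
        · rw [hdj]; exact zero_le_one
        · exact not_lt.1 (hne hl)
      · rw [hd0 l hl]) hAd
    rw [this] at hdj
    simp at hdj
  obtain ⟨k, hk, hmin⟩ := Finset.exists_min_image _ (fun l => b l / (-d l)) hneg
  rw [Finset.mem_filter] at hk
  obtain ⟨hkB, hdk⟩ := hk
  set c : ℝ := b k / (-d k) with hc
  have hcpos : 0 < c := div_pos (hbpos k hkB) (neg_pos.2 hdk)
  have hkj : k ≠ j := fun h => hj (h ▸ hkB)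
  refine ⟨k, insert j (B.erase k), hB, hj, hkB, rfl, isColumnBasis_of_eq_zero ?_ ?_,
    b + c • d, ⟨?_, ?_⟩, ?_⟩
  · rw [Finset.card_insert_of_notMem (fun h => hj (Finset.mem_of_mem_erase h)),
      Finset.card_erase_of_mem hkB, Nat.sub_add_cancel (Finset.card_pos.2 ⟨k, hkB⟩), hbas.1]
  -- Over `insert j B` the kernel is the line of `d`, and `d k < 0`, so a kernel vector that
  -- vanishes at `k` is zero.
  · intro v hv hAv
    have hsub : ∀ l ∉ insert j B, v l = 0 := fun l hl => hv l fun h => hl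
      (Finset.insert_subset_insert _ (Finset.erase_subset _ _) h)
    have hv' := hbas.eq_smul_direction hdj hd0 hAd hsub hAv
    have hk0 : v k = 0 := hv k (by simp [hkj])
    have : v j = 0 := by
      have := congrFun hv' k
      rw [hk0, Pi.smul_apply, smul_eq_mul, eq_comm, mul_eq_zero] at this
      exact this.resolve_right hdk.ne
    rw [hv', this, zero_smul]
  · rw [Matrix.mulVec_add, Matrix.mulVec_smul, hAd, smul_zero, add_zero, hb.1]
  · intro l hl
    rw [Finset.mem_insert, Finset.mem_erase, not_or, not_and_or, not_not] at hl
    by_cases hlk : l = k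
    · subst hlk
      have hne := hdk.ne
      simp only [Pi.add_apply, Pi.smul_apply, smul_eq_mul, hc]
      field_simp
      simp
    · have hlB := hl.2.resolve_left hlk
      simp [hb.2 l hlB, hd0 l (by simp [hl.1, hlB])]
  · intro l
    simp only [Pi.add_apply, Pi.smul_apply, smul_eq_mul]
    by_cases hdl : d l < 0
    · have hlB : l ∈ B := by
        by_contra h
        by_cases hlj : l = j
        · rw [hlj, hdj] at hdl; linarith
        · rw [hd0 l (by simp [hlj, h])] at hdl; exact lt_irrefl _ hdl
      have := hmin l (Finset.mem_filter.2 ⟨hlB, hdl⟩)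
      rw [le_div_iff₀ (neg_pos.2 hdl)] at this
      linarith
    · have := mul_nonneg hcpos.le (not_lt.1 hdl)
      linarith [hb0 l]

/-- Both new solutions lie on the ray from `b` along `d`, with the component `j` as parameter.
Component `k₁` decreases along the ray and is already zero at `b₁`, hence is not positive at `b₂`.
If `k₁ ≠ k₂`, then `k₁` belongs to `B₂` and this contradicts nondegeneracy. -/
lemma IsPivotStep.le_of_entering_le (hnd : IsNondegenerate A q) {j k₁ k₂ : κ} {b₁ b₂ : κ → ℝ}
    (h₁ : IsPivotStep A q B j k₁ B₁) (h₂ : IsPivotStep A q B j k₂ B₂)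
    (hb₁ : IsBasicSolution A q B₁ b₁) (hb₂ : IsBasicSolution A q B₂ b₂)
    (hp₁ : ∀ l, 0 ≤ b₁ l) (hp₂ : ∀ l, 0 ≤ b₂ l) (hle : b₁ j ≤ b₂ j) : k₁ = k₂ := by
  obtain ⟨⟨hbas, b, hb, hb0⟩, hj, hk₁, rfl, hbas₁, -⟩ := h₁
  obtain ⟨-, -, hk₂, rfl, hbas₂, -⟩ := h₂
  by_contra hne
  obtain ⟨d, hdj, hd0, hAd⟩ := hbas.exists_direction hj
  have key : ∀ (k : κ) (b' : κ → ℝ), IsBasicSolution A q (insert j (B.erase k)) b' →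
      ∀ l, b' l - b l = b' j * d l := by
    intro k b' hb' l
    have := hbas.eq_smul_direction (v := b' - b) hdj hd0 hAd (fun l hl => by
      rw [Finset.mem_insert, not_or] at hl
      have : l ∉ insert j (B.erase k) := by simp [hl.1, hl.2]
      simp [hb.2 l hl.2, hb'.2 l this]) (by
      rw [Matrix.mulVec_sub, hb'.1, hb.1, sub_self])
    have := congrFun this l
    simpa [hb.2 j hj] using this
  have hkj : k₁ ≠ j := fun h => hj (h ▸ hk₁)
  have e₁ := key k₁ b₁ hb₁ k₁
  have e₂ := key k₂ b₂ hb₂ k₁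
  have z₁ : b₁ k₁ = 0 := hb₁.2 _ (by simp [hkj])
  have hbk : 0 < b k₁ := hnd B b hbas hb hb0 k₁ hk₁
  have hj₁ : 0 < b₁ j := hnd _ _ hbas₁ hb₁ hp₁ j (by simp)
  have hk₂' : 0 < b₂ k₁ := hnd _ _ hbas₂ hb₂ hp₂ k₁ (by simp [hne, hk₁])
  have hd : d k₁ < 0 := by
    by_contra h
    have := mul_nonneg hj₁.le (not_lt.1 h)
    linarith
  nlinarith

/-- In a nondegenerate polytope the column that leaves the basis is determined. -/
lemma IsPivotStep.leaving_unique (hnd : IsNondegenerate A q) {j k₁ k₂ : κ}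
    (h₁ : IsPivotStep A q B j k₁ B₁) (h₂ : IsPivotStep A q B j k₂ B₂) : k₁ = k₂ := by
  obtain ⟨b₁, hb₁, hp₁⟩ := h₁.2.2.2.2.2
  obtain ⟨b₂, hb₂, hp₂⟩ := h₂.2.2.2.2.2
  rcases le_total (b₁ j) (b₂ j) with h | h
  · exact h₁.le_of_entering_le hnd h₂ hb₁ hb₂ hp₁ hp₂ h
  · exact (h₂.le_of_entering_le hnd h₁ hb₂ hb₁ hp₂ hp₁ h).symm

lemma IsPivotStep.reverse {j k : κ} (h : IsPivotStep A q B j k B₁) : IsPivotStep A q B₁ k j B := by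
  obtain ⟨hB, hj, hk, rfl, hB₁⟩ := h
  have hkj : k ≠ j := fun h => hj (h ▸ hk)
  refine ⟨hB₁, by simp [hkj], by simp, ?_, hB⟩
  rw [Finset.erase_insert (fun h => hj (Finset.mem_of_mem_erase h)), Finset.insert_erase hk]

end Cardinal

/-! ### Ordinal pivoting: the exchange of columns in ordinal bases. -/

section Ordinal

variable {ι κ : Type*} [Fintype ι] [Fintype κ] [DecidableEq κ] {C : Matrix ι κ ℝ}
  {O O₁ O₂ R : Finset κ} {i r : ι} {k m s : κ}

lemma exists_isRowMinimizer (C : Matrix ι κ ℝ) (hR : R.Nonempty) (i : ι) :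
    ∃ k, IsRowMinimizer C R i k :=
  Finset.exists_min_image R (C i) hR

lemma IsRowMinimizer.unique (hC : ∀ i, Function.Injective (C i)) (h : IsRowMinimizer C R i k)
    (h' : IsRowMinimizer C R i m) : k = m :=
  hC i (le_antisymm (h.2 m h'.1) (h'.2 k h.1))

lemma IsOrdinalBasis.exists_row (hO : IsOrdinalBasis C O) (hk : k ∈ O) :
    ∃ i, IsRowMinimizer C O i k :=
  let ⟨i, hi⟩ := hO.2 k
  ⟨i, hk, hi⟩

/-- A column of an ordinal basis contains exactly one row minimizer. -/
lemma IsOrdinalBasis.row_unique (hC : ∀ i, Function.Injective (C i)) (hO : IsOrdinalBasis C O)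
    (h : IsRowMinimizer C O i k) (h' : IsRowMinimizer C O r k) : i = r := by
  choose ρ hρ using fun k : O => hO.exists_row k.2
  -- Distinct entries leave one minimizer per row, so `ρ` is injective; as there are as many columns
  -- as rows, it is a bijection.
  have hinj : Function.Injective ρ := fun x y hxy =>
    Subtype.ext ((hρ x).unique hC (hxy ▸ hρ y))
  have hsurj : Function.Surjective ρ :=
    (Fintype.bijective_iff_injective_and_card ρ).2 ⟨hinj, by simp [hO.1]⟩ |>.2
  obtain ⟨x, rfl⟩ := hsurj i
  obtain ⟨y, rfl⟩ := hsurj r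
  have hx := (hρ x).unique hC h
  have hy := (hρ y).unique hC h'
  rw [Subtype.ext (hx.trans hy.symm)]

/-- If removing `k` makes a new row minimizer appear in row `r₁`, then `k` was the minimizer there. -/
lemma isRowMinimizer_of_new {r₁ : ι} (hk : k ∈ O) (h : IsRowMinimizer C (O.erase k) r₁ m)
    (h' : ¬ IsRowMinimizer C O r₁ m) : IsRowMinimizer C O r₁ k := by
  have hkm : C r₁ k < C r₁ m := by
    by_contra hle
    refine h' ⟨Finset.mem_of_mem_erase h.1, fun s hs => ?_⟩
    by_cases hsk : s = k
    · subst hsk; exact not_lt.1 hle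
    · exact h.2 s (Finset.mem_erase.2 ⟨hsk, hs⟩)
  refine ⟨hk, fun s hs => ?_⟩
  by_cases hsk : s = k
  · rw [hsk]
  · exact hkm.le.trans (h.2 s (Finset.mem_erase.2 ⟨hsk, hs⟩))

/-- A row other than that of `k` still has an entry below that of `k` once `k` is removed. -/
lemma IsOrdinalBasis.isCandidate_removed (hC : ∀ i, Function.Injective (C i))
    (hO : IsOrdinalBasis C O) (hk : IsRowMinimizer C O r k) : IsCandidate C (O.erase k) r k := by
  intro i hi
  obtain ⟨s, hs⟩ := exists_isRowMinimizer C ⟨k, hk.1⟩ i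
  have hsk : s ≠ k := fun h => hi (hO.row_unique hC (h ▸ hs) hk)
  exact ⟨s, Finset.mem_erase.2 ⟨hsk, hs.1⟩,
    lt_of_le_of_ne (hs.2 k hk.1) fun h => hsk (hC i h)⟩

/-- The ordinal condition for `j` must be witnessed by row `r`, since a candidate exceeds a
remaining entry in every other row. Consequently the entering column takes over row `r` from `m`. -/
lemma IsOrdinalBasis.entry_le_of_isCandidate (hO : IsOrdinalBasis C O)
    (hm : IsRowMinimizer C O r m) {j : κ} (hj : IsCandidate C (O.erase k) r j) :
    C r j ≤ C r m := by
  obtain ⟨i, hi⟩ := hO.2 j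
  by_cases hir : i = r
  · subst hir; exact hi m hm.1
  · obtain ⟨s, hs, hlt⟩ := hj i hir
    exact absurd (hi s (Finset.mem_of_mem_erase hs)) (not_le.2 hlt)

lemma IsOrdinalPivotStep.isOrdinalBasis {j : κ} (h : IsOrdinalPivotStep C O k j O₁) : IsOrdinalBasis C O₁ := by
  obtain ⟨hO, hk, m, r, r₁, h1, h2, h3, h4, hj, hcand, hmax, rfl⟩ := h
  refine ⟨?_, fun s => ?_⟩
  · rw [Finset.card_insert_of_notMem (fun h => hj (Finset.mem_of_mem_erase h)),
      Finset.card_erase_of_mem hk, Nat.sub_add_cancel (Finset.card_pos.2 ⟨k, hk⟩), hO.1]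
  -- A candidate is dominated in row `r`, by the maximal choice of `j`. A column that is not a
  -- candidate is dominated in the row where it fails, since `j` lies above the minimum there.
  · by_cases hs : IsCandidate C (O.erase k) r s
    · refine ⟨r, fun l hl => ?_⟩
      rcases Finset.mem_insert.1 hl with rfl | hl
      · exact hmax s hs
      · exact (hO.entry_le_of_isCandidate h4 hs).trans (h3.2 l hl)
    · simp only [IsCandidate, not_forall, not_exists, not_and, not_lt] at hs
      obtain ⟨i, hi, hs⟩ := hs
      refine ⟨i, fun l hl => ?_⟩
      rcases Finset.mem_insert.1 hl with rfl | hl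
      · obtain ⟨l', hl', hlt⟩ := hcand i hi
        exact (hs l' hl').trans hlt.le
      · exact hs l hl

/-- The rows `r` and `r₁` exchange roles: after the step `j` minimizes row `r` and `m` minimizes row
`r₁`. That `k` is the best candidate for `r₁` is the ordinal property of `O`. -/
lemma IsOrdinalPivotStep.reverse {j : κ} (hC : ∀ i, Function.Injective (C i))
    (h : IsOrdinalPivotStep C O k j O₁) : IsOrdinalPivotStep C O₁ j k O := by
  have hO₁ := h.isOrdinalBasis
  obtain ⟨hO, hk, m, r, r₁, h1, h2, h3, h4, hj, hcand, hmax, rfl⟩ := h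
  have hk₁ := isRowMinimizer_of_new hk h1 h2
  have hrr : r₁ ≠ r := fun h => h2 (h ▸ h4)
  have hkj : k ≠ j := fun h => hj (h ▸ hk)
  have hmj : m ≠ j := fun h => hj (h ▸ h4.1)
  have herase : (insert j (O.erase k)).erase j = O.erase k :=
    Finset.erase_insert (fun h => hj (Finset.mem_of_mem_erase h))
  have hjm := hO.entry_le_of_isCandidate h4 hcand
  refine ⟨hO₁, by simp, m, r₁, r, ?_, ?_, ?_, ?_, ?_, ?_, ?_, ?_⟩
  · rwa [herase]
  · intro h
    exact hmj (hC r (le_antisymm (h.2 j (by simp)) hjm))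
  · rwa [herase]
  · refine ⟨by simp [h3.1], fun s hs => ?_⟩
    rcases Finset.mem_insert.1 hs with rfl | hs
    · obtain ⟨l, hl, hlt⟩ := hcand r₁ hrr
      exact (h1.2 l hl).trans hlt.le
    · exact h1.2 s hs
  · simp [hkj]
  · rw [herase]
    exact hO.isCandidate_removed hC hk₁
  · rw [herase]
    intro s hs
    obtain ⟨i, hi⟩ := hO.2 s
    by_cases hir : i = r₁
    · subst hir; exact hi k hk
    · obtain ⟨l, hl, hlt⟩ := hs i hir
      exact absurd (hi l (Finset.mem_of_mem_erase hl)) (not_le.2 hlt)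
  · rw [herase, Finset.insert_erase hk]

/-- All data are forced: `r₁` is the row of `k`, `m` the minimizer of that row among the remaining
columns, `r` the row of `m`, and `j` the maximizer in row `r`. -/
lemma IsOrdinalPivotStep.entering_unique {j₁ j₂ : κ} (hC : ∀ i, Function.Injective (C i))
    (h : IsOrdinalPivotStep C O k j₁ O₁) (h' : IsOrdinalPivotStep C O k j₂ O₂) : j₁ = j₂ := by
  obtain ⟨hO, hk, m, r, r₁, h1, h2, h3, h4, hj, hcand, hmax, -⟩ := h
  obtain ⟨-, -, m', r', r₁', h1', h2', h3', h4', hj', hcand', hmax', -⟩ := h'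
  have e₁ : r₁ = r₁' :=
    hO.row_unique hC (isRowMinimizer_of_new hk h1 h2) (isRowMinimizer_of_new hk h1' h2')
  subst e₁
  have e₂ : m = m' := h1.unique hC h1'
  subst e₂
  have e₃ : r = r' := hO.row_unique hC h4 h4'
  subst e₃
  exact hC r (le_antisymm (hmax' _ hcand) (hmax _ hcand'))

/-- An ordinal pivot step can be carried out if for every row there is a column that is a candidate
for that row. -/
lemma IsOrdinalBasis.exists_ordinalPivotStep (hC : ∀ i, Function.Injective (C i))
    (hO : IsOrdinalBasis C O) (hk : k ∈ O) (hne : (O.erase k).Nonempty)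
    (hcand : ∀ r, ∃ j, IsCandidate C (O.erase k) r j) :
    ∃ j O₁, IsOrdinalPivotStep C O k j O₁ := by
  classical
  obtain ⟨r₁, hk₁⟩ := hO.exists_row hk
  obtain ⟨m, hm⟩ := exists_isRowMinimizer C hne r₁
  have hmO := Finset.mem_of_mem_erase hm.1
  obtain ⟨r, hr⟩ := hO.exists_row hmO
  have hmk : m ≠ k := (Finset.mem_erase.1 hm.1).1
  have hrr : r₁ ≠ r := fun h => hmk (hr.unique hC (h ▸ hk₁))
  have hcn : (Finset.univ.filter fun j => IsCandidate C (O.erase k) r j).Nonempty :=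
    let ⟨j, hj⟩ := hcand r
    ⟨j, by simpa using hj⟩
  obtain ⟨j, hj, hmax⟩ := Finset.exists_max_image _ (C r) hcn
  simp only [Finset.mem_filter, Finset.mem_univ, true_and] at hj hmax
  have h2 : ¬ IsRowMinimizer C O r₁ m := fun h => hmk (h.unique hC hk₁)
  refine ⟨j, _, hO, hk, m, r, r₁, hm, h2, ⟨hm.1, fun s hs => hr.2 s (Finset.mem_of_mem_erase hs)⟩,
    hr, fun hjO => ?_, hj, hmax, rfl⟩
  -- No column of `O` is a candidate for `r`: `m` is minimal in row `r₁` among the remaining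
  -- columns, and any other column is minimal in its own row, which is not `r`.
  by_cases hjm : j = m
  · subst hjm
    obtain ⟨s, hs, hlt⟩ := hj r₁ hrr
    exact absurd (hm.2 s hs) (not_le.2 hlt)
  · obtain ⟨i, hi⟩ := hO.exists_row hjO
    have hir : i ≠ r := fun h => hjm ((h ▸ hi).unique hC hr)
    obtain ⟨s, hs, hlt⟩ := hj i hir
    exact absurd (hi.2 s (Finset.mem_of_mem_erase hs)) (not_le.2 hlt)

lemma IsTopColumns.unique (h : IsTopColumns C i O) (h' : IsTopColumns C i O₁) : O = O₁ := by
  have hsub : O ⊆ O₁ := by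
    intro k hk
    by_contra hk'
    have : ¬ O₁ ⊆ O := fun hs => hk' (Finset.eq_of_subset_of_card_le hs (by rw [h.1, h'.1]) ▸ hk)
    obtain ⟨s, hs, hs'⟩ := Finset.not_subset.1 this
    exact lt_asymm (h.2 k hk s hs') (h'.2 s hs k hk')
  exact Finset.eq_of_subset_of_card_le hsub (by rw [h.1, h'.1])

end Ordinal

/-! ### Paths of deterministic reversible relations. -/

section ReversiblePath

variable {S : Type*} {T : S → S → Prop}

lemma exists_seq_of_reflTransGen {a b : S} (h : Relation.ReflTransGen T a b) :
    ∃ (n : ℕ) (p : ℕ → S), p 0 = a ∧ p n = b ∧ ∀ k < n, T (p k) (p (k + 1)) := by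
  induction h using Relation.ReflTransGen.head_induction_on with
  | refl => exact ⟨0, fun _ => b, rfl, rfl, by simp⟩
  | head hab _ ih =>
    rename_i x _ _
    obtain ⟨n, p, h0, hn, hp⟩ := ih
    refine ⟨n + 1, Nat.rec (motive := fun _ => S) x fun k _ => p k, rfl, hn, fun k hk => ?_⟩
    cases k with
    | zero => rw [← h0] at hab; exact hab
    | succ k => exact hp k (by omega)

/-- In a deterministic relation that is reversed by `rev`, no path leads from a state to its
reverse. -/
lemma not_reflTransGen_rev (rev : S → S) (hdet : ∀ a b c, T a b → T a c → b = c)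
    (hrev : ∀ a b, T a b → T (rev b) (rev a)) (hinv : ∀ a, rev (rev a) = a)
    (hne : ∀ a b, T a b → b ≠ rev a) {a : S} (hfix : ∀ b, Relation.ReflTransGen T a b → rev b ≠ b) :
    ¬ Relation.ReflTransGen T a (rev a) := by
  intro h
  obtain ⟨n, p, h0, hn, hp⟩ := exists_seq_of_reflTransGen h
  have hreach : ∀ k ≤ n, Relation.ReflTransGen T a (p k) := by
    intro k
    induction k with
    | zero => intro _; rw [h0]
    | succ k ih => intro hk; exact (ih (by omega)).tail (hp k (by omega))
  -- The reversed path also starts at `a`, so by determinism it is the same path: the path is a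
  -- palindrome.
  have key : ∀ k ≤ n, p k = rev (p (n - k)) := by
    intro k
    induction k with
    | zero => intro _; rw [Nat.sub_zero, hn, hinv, h0]
    | succ k ih =>
      intro hk
      have h1 := hrev _ _ (hp (n - (k + 1)) (by omega))
      rw [show n - (k + 1) + 1 = n - k by omega, ← ih (by omega)] at h1
      exact hdet _ _ _ (hp k (by omega)) h1
  -- For even length the middle state is its own reverse; for odd length the middle step leads from
  -- a state to its reverse.
  rcases Nat.even_or_odd' n with ⟨c, hc | hc⟩
  · have := key c (by omega)
    rw [show n - c = c by omega] at this
    exact hfix _ (hreach c (by omega)) this.symm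
  · have := key (c + 1) (by omega)
    rw [show n - (c + 1) = c by omega] at this
    exact hne _ _ (hp c (by omega)) this

/-- In a deterministic relation that is reversed by `rev`, no state reachable from a state without
predecessors occurs twice. -/
lemma not_transGen_self (rev : S → S) (hdet : ∀ a b c, T a b → T a c → b = c)
    (hrev : ∀ a b, T a b → T (rev b) (rev a)) (hinv : ∀ a, rev (rev a) = a) {s a : S}
    (hs : ∀ b, ¬ T (rev s) b) (ha : Relation.ReflTransGen T s a) : ¬ Relation.TransGen T a a := by
  induction ha with
  | refl =>
    intro h
    obtain ⟨c, -, hc⟩ := Relation.TransGen.tail'_iff.1 h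
    exact hs _ (hrev _ _ hc)
  | tail _ hab ih =>
    intro h
    rename_i x y _
    obtain ⟨c, hbc, hcb⟩ := Relation.TransGen.tail'_iff.1 h
    -- Determinism of the reversed steps makes predecessors unique, so a cycle through `y` also
    -- passes through `x`, and thus can be traced back to `s`.
    have : c = x := by
      have := hdet _ _ _ (hrev _ _ hcb) (hrev _ _ hab)
      rw [← hinv c, this, hinv]
    subst this
    exact ih (Relation.TransGen.head' hab hbc)

end ReversiblePath

/-! ### States of the algorithm and reversal of its steps. -/

namespace ScarfState

variable {ι κ : Type*} [Fintype ι] [Fintype κ] [DecidableEq κ] {A : Matrix ι κ ℝ} {q : ι → ℝ}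
  {C : Matrix ι κ ℝ} {e : κ} {S S' S₀ : ScarfState κ}

/-- The state with the same bases from which the algorithm runs backwards. -/
def rev : ScarfState κ → ScarfState κ
  | cardinal B O j => ordinal B O j
  | ordinal B O j => cardinal B O j
  | terminated B O => terminated B O

@[simp] lemma rev_rev (S : ScarfState κ) : S.rev.rev = S := by cases S <;> rfl

/-- The bases of a state which has not terminated are a feasible and an ordinal basis; they differ
in one column, and the column of the feasible basis outside the ordinal basis is `e`. -/
def IsLive (A : Matrix ι κ ℝ) (q : ι → ℝ) (C : Matrix ι κ ℝ) (e : κ) : ScarfState κ → Prop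
  | cardinal B O j =>
    IsFeasibleBasis A q B ∧ IsOrdinalBasis C O ∧ B \ O = {e} ∧ O \ B = {j}
  | ordinal B O j =>
    IsFeasibleBasis A q B ∧ IsOrdinalBasis C O ∧ B \ O = {e} ∧ O \ B = {j}
  | terminated _ _ => False

lemma IsLive.rev (h : S.IsLive A q C e) : S.rev.IsLive A q C e := by
  cases S <;> exact h

lemma IsLive.rev_ne (h : S.IsLive A q C e) : S.rev ≠ S := by
  cases S <;> simp_all [ScarfState.rev, IsLive]

lemma IsLive.feasible (h : S.IsLive A q C e) : IsFeasibleBasis A q S.basisA := by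
  cases S
  exacts [h.1, h.1, h.elim]

lemma IsLive.ordinal (h : S.IsLive A q C e) : IsOrdinalBasis C S.basisC := by
  cases S
  exacts [h.2.1, h.2.1, h.elim]

lemma IsLive.sdiff (h : S.IsLive A q C e) : S.basisA \ S.basisC = {e} := by
  cases S
  exacts [h.2.2.1, h.2.2.1, h.elim]

/-- `O \ B` determines the column, so only the direction is free. A repeated pair of bases is thus a
repeated state or its reverse. -/
lemma IsLive.eq_or_eq_rev (h : S.IsLive A q C e) (h' : S'.IsLive A q C e)
    (hA : S.basisA = S'.basisA) (hO : S.basisC = S'.basisC) : S' = S ∨ S' = S.rev := by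
  cases S <;> cases S' <;> simp only [IsLive] at h h' <;>
    simp only [basisA, basisC] at hA hO <;> subst hA hO <;>
    obtain ⟨-, -, -, h⟩ := h <;> obtain ⟨-, -, -, h'⟩ := h' <;>
    rw [h, Finset.singleton_inj] at h' <;> subst h' <;> simp [ScarfState.rev]

/-- A step of the algorithm between states that have not terminated. -/
def LiveStep (A : Matrix ι κ ℝ) (q : ι → ℝ) (C : Matrix ι κ ℝ) (e : κ) (S S' : ScarfState κ) :
    Prop :=
  S.IsLive A q C e ∧ S'.IsLive A q C e ∧ ScarfStep A q C S S'

lemma _root_.ScarfStep.deterministic (hnd : IsNondegenerate A q)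
    (hC : ∀ i, Function.Injective (C i)) {S₁ S₂ : ScarfState κ} (h₁ : ScarfStep A q C S S₁)
    (h₂ : ScarfStep A q C S S₂) : S₁ = S₂ := by
  have aux : ∀ {B j k₁ k₂ B₁ B₂}, IsPivotStep A q B j k₁ B₁ → IsPivotStep A q B j k₂ B₂ →
      k₁ = k₂ ∧ B₁ = B₂ := by
    intro B j k₁ k₂ B₁ B₂ h h'
    have := h.leaving_unique hnd h'
    subst this
    exact ⟨rfl, h.2.2.2.1.trans h'.2.2.2.1.symm⟩
  have aux' : ∀ {O k j₁ j₂ O₁ O₂}, IsOrdinalPivotStep C O k j₁ O₁ →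
      IsOrdinalPivotStep C O k j₂ O₂ → j₁ = j₂ ∧ O₁ = O₂ := by
    intro O k j₁ j₂ O₁ O₂ h h'
    have := h.entering_unique hC h'
    subst this
    obtain ⟨-, -, m, r, r₁, -, -, -, -, -, -, -, e⟩ := h
    obtain ⟨-, -, m, r, r₁, -, -, -, -, -, -, -, e'⟩ := h'
    exact ⟨rfl, e.trans e'.symm⟩
  cases h₁ <;> cases h₂ <;> rename_i h _ _ _ _ h'
  all_goals first
    | (obtain ⟨rfl, rfl⟩ := aux h h'
       first | rfl | contradiction)
    | (obtain ⟨rfl, rfl⟩ := aux' h h'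
       first | rfl | contradiction)

/-- If `e` leaves `B`, or enters `O`, the two bases become equal. Any other exchange keeps `e` as
the only column of `B \ O`. -/
lemma IsLive.step (h : S.IsLive A q C e) (hs : ScarfStep A q C S S') :
    S'.IsLive A q C e ∨
      ∃ B, S' = terminated B B ∧ IsFeasibleBasis A q B ∧ IsOrdinalBasis C B := by
  cases hs with
  | cardinal_terminate B O B₁ j k hp hEq =>
    subst hEq
    exact .inr ⟨_, rfl, hp.2.2.2.2, h.2.1⟩
  | ordinal_terminate B O O₁ k j hp hEq =>
    subst hEq
    exact .inr ⟨_, rfl, h.1, hp.isOrdinalBasis⟩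
  | cardinal_continue B O B₁ j k hp hNe =>
    obtain ⟨-, hO, he, hj⟩ := h
    obtain ⟨-, hjB, hk, rfl, hB₁⟩ := hp
    simp only [Finset.ext_iff, Finset.mem_sdiff, Finset.mem_singleton, ne_eq, Finset.mem_insert,
      Finset.mem_erase] at he hj hNe
    have hkO : k ∈ O := by
      by_contra hkO
      have := (he k).1 ⟨hk, hkO⟩
      subst this
      exact hNe fun a => by grind
    refine .inl ⟨hB₁, hO, ?_, ?_⟩ <;> ext a <;>
      simp only [Finset.mem_sdiff, Finset.mem_singleton, Finset.mem_insert, Finset.mem_erase] <;>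
      grind
  | ordinal_continue B O O₁ k j hp hNe =>
    have hO₁ := hp.isOrdinalBasis
    obtain ⟨hB, -, he, hk⟩ := h
    obtain ⟨-, hkO, m, r, r₁, -, -, -, -, hjO, -, -, rfl⟩ := hp
    simp only [Finset.ext_iff, Finset.mem_sdiff, Finset.mem_singleton, ne_eq, Finset.mem_insert,
      Finset.mem_erase] at he hk hNe
    have hjB : j ∉ B := by
      intro hjB
      have := (he j).1 ⟨hjB, hjO⟩
      subst this
      exact hNe fun a => by grind
    refine .inl ⟨hB, hO₁, ?_, ?_⟩ <;> ext a <;>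
      simp only [Finset.mem_sdiff, Finset.mem_singleton, Finset.mem_insert, Finset.mem_erase] <;>
      grind

lemma IsLive.ne (h : S.IsLive A q C e) : S.basisA ≠ S.basisC := by
  intro hE
  have := h.sdiff
  rw [hE, Finset.sdiff_self] at this
  exact absurd this.symm (Finset.singleton_ne_empty e)

lemma LiveStep.rev (hC : ∀ i, Function.Injective (C i)) (h : LiveStep A q C e S S') :
    LiveStep A q C e S'.rev S.rev := by
  obtain ⟨h, h', hs⟩ := h
  refine ⟨h'.rev, h.rev, ?_⟩
  have hne := h.ne
  cases hs with
  | cardinal_terminate B O B₁ j k hp hEq => exact h'.elim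
  | ordinal_terminate B O O₁ k j hp hEq => exact h'.elim
  | cardinal_continue B O B₁ j k hp hNe => exact .cardinal_continue _ _ _ _ _ hp.reverse hne
  | ordinal_continue B O O₁ k j hp hNe => exact .ordinal_continue _ _ _ _ _ (hp.reverse hC) hne.symm

lemma LiveStep.ne_rev (h : LiveStep A q C e S S') : S' ≠ S.rev := by
  obtain ⟨h, h', hs⟩ := h
  cases hs with
  | cardinal_terminate B O B₁ j k hp hEq => exact h'.elim
  | ordinal_terminate B O O₁ k j hp hEq => exact h'.elim
  | cardinal_continue B O B₁ j k hp hNe =>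
    intro hE
    simp only [ScarfState.rev, ordinal.injEq, true_and] at hE
    obtain ⟨-, hj, -, h4, -⟩ := hp
    exact hj (hE.1 ▸ h4 ▸ Finset.mem_insert_self _ _)
  | ordinal_continue B O O₁ k j hp hNe =>
    intro hE
    simp only [ScarfState.rev, cardinal.injEq, true_and] at hE
    obtain ⟨-, hkO, m, r, r₁, -, -, -, -, hjO, -, -, h4⟩ := hp
    exact hjO (hE.1 ▸ h4 ▸ Finset.mem_insert_self _ _)

lemma not_scarfStep_terminated {B O : Finset κ} : ¬ ScarfStep A q C (.terminated B O) S :=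
  fun h => nomatch h

/-- A state reached from a live state is live, or the algorithm has terminated with a common
feasible and ordinal basis. -/
lemma IsLive.reach (h₀ : S₀.IsLive A q C e) (h : Relation.ReflTransGen (ScarfStep A q C) S₀ S) :
    (S.IsLive A q C e ∧ Relation.ReflTransGen (LiveStep A q C e) S₀ S) ∨
      ∃ B, S = terminated B B ∧ IsFeasibleBasis A q B ∧ IsOrdinalBasis C B := by
  induction h with
  | refl => exact .inl ⟨h₀, .refl⟩
  | tail _ hs ih =>
    rcases ih with ⟨hl, hr⟩ | ⟨B, rfl, -⟩
    · rcases hl.step hs with hl' | ht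
      · exact .inl ⟨hl', hr.tail ⟨hl, hl', hs⟩⟩
      · exact .inr ht
    · exact absurd hs not_scarfStep_terminated

/-! ### No pair of bases recurs, and the run is finite. -/

section Run

variable (hnd : IsNondegenerate A q) (hC : ∀ i, Function.Injective (C i))
  (h₀ : S₀.IsLive A q C e)

include hnd hC in
lemma not_reach_rev (h : Relation.ReflTransGen (LiveStep A q C e) S S.rev)
    (hl : S.IsLive A q C e) : False := by
  refine not_reflTransGen_rev ScarfState.rev (fun a b c hab hac => hab.2.2.deterministic hnd hC hac.2.2)
    (fun a b h => h.rev hC) rev_rev (fun a b h => h.ne_rev) (fun b hb => ?_) h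
  rcases Relation.ReflTransGen.cases_tail hb with rfl | ⟨c, -, hc⟩
  · exact hl.rev_ne
  · exact hc.2.1.rev_ne

include hnd hC h₀ in
/-- A run from a live state whose reverse has no successor never returns to a pair of bases. -/
lemma IsLive.bases_ne (hstart : ∀ S, ¬ LiveStep A q C e S₀.rev S)
    (h : Relation.ReflTransGen (ScarfStep A q C) S₀ S)
    (h' : Relation.TransGen (ScarfStep A q C) S S') :
    (S.basisA, S.basisC) ≠ (S'.basisA, S'.basisC) := by
  intro hE
  rw [Prod.mk.injEq] at hE
  rcases h₀.reach h with ⟨hl, hr⟩ | ⟨B, rfl, -⟩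
  swap
  · obtain ⟨c, hc, -⟩ := Relation.TransGen.head'_iff.1 h'
    exact not_scarfStep_terminated hc
  rcases hl.reach h'.to_reflTransGen with ⟨hl', hr'⟩ | ⟨B, rfl, -⟩
  swap
  · exact hl.ne (hE.1.trans hE.2.symm)
  rcases hl.eq_or_eq_rev hl' hE.1 hE.2 with rfl | rfl
  · obtain ⟨c, hsc, hcs⟩ := Relation.TransGen.head'_iff.1 h'
    rcases hl.step hsc with hlc | ⟨B, rfl, -⟩
    · rcases hlc.reach hcs with ⟨-, hr''⟩ | ⟨B, rfl, -⟩
      · exact not_transGen_self ScarfState.rev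
          (fun a b c hab hac => hab.2.2.deterministic hnd hC hac.2.2)
          (fun a b h => h.rev hC) rev_rev hstart hr (.head' ⟨hl, hlc, hsc⟩ hr'')
      · exact hl
    · rcases Relation.ReflTransGen.cases_head hcs with rfl | ⟨c, hc, -⟩
      · exact hl
      · exact not_scarfStep_terminated hc
  · exact not_reach_rev hnd hC hr' hl

-- An infinite run would inject `ℕ` into the finite set of pairs of column sets.
include hnd hC h₀ in
lemma IsLive.no_infinite_run (hstart : ∀ S, ¬ LiveStep A q C e S₀.rev S) :
    ¬ ∃ run : ℕ → ScarfState κ, run 0 = S₀ ∧ ∀ s, ScarfStep A q C (run s) (run (s + 1)) := by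
  rintro ⟨run, h0, hrun⟩
  have hreach : ∀ s t, s ≤ t → Relation.ReflTransGen (ScarfStep A q C) (run s) (run t) :=
    fun s t hst => Nat.le_induction .refl (fun t _ ih => ih.tail (hrun t)) t hst
  have hlt : ∀ s t, s < t →
      ((run s).basisA, (run s).basisC) ≠ ((run t).basisA, (run t).basisC) := fun s t hst =>
    h₀.bases_ne hnd hC hstart (h0 ▸ hreach 0 s (Nat.zero_le s)) (.head' (hrun s) (hreach _ _ hst))
  refine not_injective_infinite_finite (fun s => ((run s).basisA, (run s).basisC)) fun s t hst => ?_
  rcases lt_trichotomy s t with h | h | h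
  · exact absurd hst (hlt s t h)
  · exact h
  · exact absurd hst.symm (hlt t s h)

include hnd hC h₀ in
lemma IsLive.exists_terminated (hstart : ∀ S, ¬ LiveStep A q C e S₀.rev S)
    (hprog : ∀ S, Relation.ReflTransGen (ScarfStep A q C) S₀ S → ¬ S.IsTerminated →
      ∃ S', ScarfStep A q C S S') :
    ∃ B O, Relation.ReflTransGen (ScarfStep A q C) S₀ (.terminated B O) := by
  by_contra hno
  have hnt : ∀ S, Relation.ReflTransGen (ScarfStep A q C) S₀ S → ¬ S.IsTerminated := by
    intro S hS hT
    cases S with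
    | terminated B O => exact hno ⟨B, O, hS⟩
    | _ => exact hT
  choose next hnext using fun S : {S // Relation.ReflTransGen (ScarfStep A q C) S₀ S} =>
    hprog S.1 S.2 (hnt S.1 S.2)
  let run : ℕ → {S // Relation.ReflTransGen (ScarfStep A q C) S₀ S} :=
    fun n => Nat.rec ⟨S₀, .refl⟩ (fun _ S => ⟨next S, S.2.tail (hnext S)⟩) n
  exact h₀.no_infinite_run hnd hC hstart ⟨fun n => (run n).1, rfl, fun n => hnext (run n)⟩

end Run

end ScarfState

/-! ### The matrices of a matching market and the first bases. -/

namespace Market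

variable {F W X : Type*} [DecidableEq F] [DecidableEq W] [DecidableEq X] {M : Market F W X}

lemma IsAcceptable.nonempty {f : F} {Y : Finset X} (h : M.IsAcceptable f Y) : Y.Nonempty := by
  rw [Finset.nonempty_iff_ne_empty]
  rintro rfl
  exact (M.firmPref_strict f).irrefl ⟨∅, h.1⟩ h.2

lemma IsAcceptable.firms_eq {f : F} {Y : Finset X} (h : M.IsAcceptable f Y) : M.firms Y = {f} := by
  obtain ⟨x, hx⟩ := h.nonempty
  refine Finset.eq_singleton_iff_unique_mem.2 ⟨?_, ?_⟩
  · exact Finset.mem_image.2 ⟨x, hx, h.1.1 x hx⟩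
  · intro g hg
    obtain ⟨y, hy, rfl⟩ := Finset.mem_image.1 hg
    exact h.1.1 y hy

lemma mem_agents_inl {f : F} {Y : Finset X} : Sum.inl f ∈ M.agents Y ↔ f ∈ M.firms Y := by
  simp [agents]

lemma mem_agents_inr {w : W} {Y : Finset X} : Sum.inr w ∈ M.agents Y ↔ w ∈ M.workers Y := by
  simp [agents]

lemma Acceptable.agents_nonempty (Y : M.Acceptable) : ∃ k, k ∈ M.agents Y.1 := by
  obtain ⟨f, hf⟩ := Y.2
  exact ⟨.inl f, mem_agents_inl.2 (by simp [hf.firms_eq])⟩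

variable [Fintype F] [Fintype W] [Fintype X] {π : M.Scheme} {C : Matrix (F ⊕ W) M.Column ℝ}
  {B O : Finset M.Column} {b : M.Column → ℝ} {i : F ⊕ W}

lemma Scheme.rate_nonneg (π : M.Scheme) (Y : M.Acceptable) (i : F ⊕ W) : 0 ≤ π.rate Y i := by
  by_cases h : i ∈ M.agents Y.1
  · exact (π.rate_pos Y i h).le
  · exact (π.rate_zero Y i h).ge

lemma Scheme.matrix_mulVec (π : M.Scheme) (b : M.Column → ℝ) (i : F ⊕ W) :
    π.matrix.mulVec b i = b (.inl i) + ∑ Y, b (.inr Y) * π.rate Y i := by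
  rw [Matrix.mulVec, dotProduct, Fintype.sum_sum_type]
  congr 1
  · simp [Scheme.matrix, Matrix.one_apply]
  · exact Finset.sum_congr rfl fun Y _ => mul_comm _ _

/-- The polytope of a scheme is bounded. -/
lemma Scheme.eq_zero_of_nonneg (π : M.Scheme) (d : M.Column → ℝ) (hd : ∀ j, 0 ≤ d j)
    (h : π.matrix.mulVec d = 0) : d = 0 := by
  have hrow : ∀ i, d (.inl i) = 0 ∧ ∀ Y, d (.inr Y) * π.rate Y i = 0 := by
    intro i
    have hnn : ∀ Y ∈ Finset.univ, 0 ≤ d (.inr Y) * π.rate Y i := fun Y _ =>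
      mul_nonneg (hd _) (π.rate_nonneg Y i)
    have hi := congrFun h i
    rw [π.matrix_mulVec, Pi.zero_apply,
      add_eq_zero_iff_of_nonneg (hd _) (Finset.sum_nonneg hnn)] at hi
    exact ⟨hi.1, fun Y => (Finset.sum_eq_zero_iff_of_nonneg hnn).1 hi.2 Y (Finset.mem_univ Y)⟩
  ext j
  rcases j with i | Y
  · exact (hrow i).1
  · obtain ⟨k, hk⟩ := Y.agents_nonempty
    exact (mul_eq_zero.1 ((hrow k).2 Y)).resolve_right (π.rate_pos Y k hk).ne'

variable (M) in
/-- The columns of the agents, the first feasible basis. -/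
abbrev agentColumns : Finset M.Column := Finset.univ.image Sum.inl

lemma card_agentColumns : (M.agentColumns).card = Fintype.card (F ⊕ W) := by
  rw [Finset.card_image_of_injective _ Sum.inl_injective, Finset.card_univ]

lemma Scheme.isFeasibleBasis_agentColumns (π : M.Scheme) :
    IsFeasibleBasis π.matrix π.cap M.agentColumns := by
  refine ⟨isColumnBasis_of_eq_zero card_agentColumns fun v hv hAv => ?_,
    Sum.elim π.cap fun _ => 0, ⟨?_, ?_⟩, ?_⟩
  · have hY : ∀ Y, v (.inr Y) = 0 := fun Y => hv _ (by simp)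
    ext j
    rcases j with i | Y
    · have := congrFun hAv i
      simpa [π.matrix_mulVec, hY] using this
    · exact hY Y
  · ext i
    simp [π.matrix_mulVec]
  · rintro (i | Y) h
    · simp at h
    · rfl
  · rintro (i | Y)
    · exact (π.cap_pos i).le
    · exact le_rfl

namespace IsUtilityMatrix

lemma nonneg (hC : M.IsUtilityMatrix C) (i : F ⊕ W) (j : M.Column) : 0 ≤ C i j := by
  by_cases h : j = .inl i
  · rw [h, hC.diag]
  · exact (hC.pos i j h).le

/-- In row `i` the other agents have the largest entries, the assignments come next, and the zero of
agent `i` is last. So the top columns are the other agents and the best assignment. -/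
lemma isTopColumns_insert (hC : M.IsUtilityMatrix C) (i : F ⊕ W) {Y : M.Acceptable}
    (hY : ∀ Z, C i (.inr Z) ≤ C i (.inr Y)) :
    IsTopColumns C i (insert (.inr Y) (M.agentColumns.erase (.inl i))) := by
  have hi : (Sum.inl i : M.Column) ∈ M.agentColumns := by simp
  refine ⟨?_, ?_⟩
  · rw [Finset.card_insert_of_notMem (by simp), Finset.card_erase_of_mem hi,
      Nat.sub_add_cancel (Finset.card_pos.2 ⟨_, hi⟩), card_agentColumns]
  · rintro (j | Z) hk (a | V) hs
    · have hai : a = i := by simpa using hs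
      have hji : j ≠ i := by simpa using hk
      subst hai
      rw [hC.diag]
      exact hC.pos _ _ (by simpa using hji)
    · have hji : j ≠ i := by simpa using hk
      exact hC.offdiag i j V hji.symm
    · have hai : a = i := by simpa using hs
      subst hai
      rw [hC.diag]
      exact hC.pos _ _ (by simp)
    · have hZ : Z = Y := by simpa using hk
      have hV : V ≠ Y := by simpa using hs
      subst hZ
      exact lt_of_le_of_ne (hY V) fun h => hV (Sum.inr_injective (hC.row_injective i h))

lemma isTopColumns_agentColumns [IsEmpty M.Acceptable] (C : Matrix (F ⊕ W) M.Column ℝ)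
    (i : F ⊕ W) : IsTopColumns C i M.agentColumns := by
  refine ⟨card_agentColumns, ?_⟩
  rintro k - (a | V) hs
  · simp at hs
  · exact isEmptyElim V

lemma isOrdinalBasis_agentColumns [IsEmpty M.Acceptable] (hC : M.IsUtilityMatrix C) :
    IsOrdinalBasis C M.agentColumns := by
  refine ⟨card_agentColumns, ?_⟩
  rintro (i | Y)
  · exact ⟨i, fun k _ => by rw [hC.diag]; exact hC.nonneg i k⟩
  · exact isEmptyElim Y

/-- The first ordinal basis, for the initial row `i`. -/
lemma isOrdinalBasis_insert (hC : M.IsUtilityMatrix C) (i : F ⊕ W) {Y : M.Acceptable}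
    (hY : ∀ Z, C i (.inr Z) ≤ C i (.inr Y)) :
    IsOrdinalBasis C (insert (.inr Y) (M.agentColumns.erase (.inl i))) := by
  refine ⟨(hC.isTopColumns_insert i hY).1, ?_⟩
  rintro (a | V)
  · exact ⟨a, fun k _ => by rw [hC.diag]; exact hC.nonneg a k⟩
  · refine ⟨i, ?_⟩
    rintro (j | Z) hk
    · have hji : j ≠ i := by simpa using hk
      exact (hC.offdiag i j V hji.symm).le
    · have hZ : Z = Y := by simpa using hk
      exact hZ ▸ hY V

/-- An ordinal basis that contains all agent columns except that of `i` consists of the top columns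
of row `i`. -/
lemma isTopColumns_of_isOrdinalBasis (hC : M.IsUtilityMatrix C) {O : Finset M.Column}
    (hO : IsOrdinalBasis C O) (hsub : M.agentColumns.erase (.inl i) ⊆ O) (hi : .inl i ∉ O) :
    IsTopColumns C i O := by
  refine ⟨hO.1, ?_⟩
  rintro k hk (a | V) hs
  · have : a = i := by
      by_contra h
      exact hs (hsub (by simpa using h))
    subst this
    rw [hC.diag]
    exact hC.pos _ _ fun h => hi (h ▸ hk)
  · obtain ⟨a, ha⟩ := hO.2 (.inr V)
    -- For `a ≠ i` the column of `a` is in `O` and has entry zero in row `a`, below the positive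
    -- entry of `V`.
    have : a = i := by
      by_contra h
      have h1 := ha (.inl a) (hsub (by simpa using h))
      rw [hC.diag] at h1
      exact absurd h1 (not_le.2 (hC.pos _ _ (by simp)))
    subst this
    exact lt_of_le_of_ne (ha k hk) fun h => hs (hC.row_injective a h ▸ hk)

/-- The ordinal pivot step that would remove all but agent columns cannot be carried out. -/
lemma not_isOrdinalPivotStep (hC : M.IsUtilityMatrix C) {O O₁ : Finset M.Column} {k j : M.Column}
    (hO : O.erase k = M.agentColumns.erase (.inl i)) : ¬ IsOrdinalPivotStep C O k j O₁ := by
  rintro ⟨-, hk, m, r, r₁, h1, h2, h3, h4, hj, hcand, -, -⟩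
  rw [hO] at h1 h3 hcand
  obtain ⟨hm, -⟩ := id h1
  rcases m with a | V
  swap
  · simp at hm
  have hai : a ≠ i := by simpa using hm
  have aux : ∀ r, r ≠ i → IsRowMinimizer C (M.agentColumns.erase (.inl i)) r (.inl a) → a = r := by
    intro r hr h
    by_contra har
    have := h.2 (.inl r) (by simpa using hr)
    rw [hC.diag] at this
    exact absurd this (not_le.2 (hC.pos _ _ (by simpa using har)))
  -- A row other than `i` is minimized by the zero of its own agent, already over all of `O`, so
  -- only row `i` can have a new minimizer.
  have hr₁ : r₁ = i := by
    by_contra hne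
    have := aux r₁ hne h1
    subst this
    exact h2 ⟨h4.1, fun s _ => by rw [hC.diag]; exact hC.nonneg a s⟩
  subst hr₁
  have hr : r₁ ≠ r := fun h => h2 (h ▸ h4)
  -- In row `r₁` the entering column would have to exceed an off-diagonal agent entry. Assignments
  -- and the agent `r₁` itself lie below all of these, and the other agents are already in `O`.
  obtain ⟨s, hs, hlt⟩ := hcand r₁ hr
  rcases s with c | V
  swap
  · simp at hs
  have hc : c ≠ r₁ := by simpa using hs
  rcases j with l | V
  · by_cases hl : l = r₁
    · subst hl
      rw [hC.diag] at hlt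
      exact absurd hlt (not_lt.2 (hC.nonneg _ _))
    · have : (Sum.inl l : M.Column) ∈ O.erase k := by rw [hO]; simpa using hl
      exact hj (Finset.mem_of_mem_erase this)
  · exact lt_asymm hlt (hC.offdiag _ _ _ hc.symm)

/-- If some column of an assignment remains, then the ordinal pivot step can be carried out. -/
lemma exists_ordinalPivotStep (hC : M.IsUtilityMatrix C) {O : Finset M.Column} {k : M.Column}
    (hO : IsOrdinalBasis C O) (hk : k ∈ O) {Y : M.Acceptable} (hY : .inr Y ∈ O.erase k) :
    ∃ j O₁, IsOrdinalPivotStep C O k j O₁ :=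
  hO.exists_ordinalPivotStep hC.row_injective hk ⟨_, hY⟩ fun r =>
    -- The column of agent `r` is a candidate for row `r`: in every other row it exceeds the
    -- assignment `Y`.
    ⟨.inl r, fun i hi => ⟨.inr Y, hY, hC.offdiag i r Y hi⟩⟩

end IsUtilityMatrix

/-- The basic solution of a basis which is both feasible and ordinal yields a stable matching. -/
lemma isStable_of_basis (hC : M.IsUtilityMatrix C) (hO : IsOrdinalBasis C B)
    (hbas : IsBasicSolution π.matrix π.cap B b) (hb : ∀ j, 0 ≤ b j) :
    π.IsStableScheduleMatching fun Y => b (.inr Y) := by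
  have hrow : ∀ i, b (.inl i) + ∑ Y, b (.inr Y) * π.rate Y i = π.cap i := fun i => by
    rw [← π.matrix_mulVec, hbas.1]
  have hmem : ∀ j, 0 < b j → j ∈ B := fun j hj => by
    by_contra h
    exact hj.ne' (hbas.2 j h)
  refine ⟨⟨fun Y => hb _, fun i => by linarith [hrow i, hb (.inl i)]⟩, ?_⟩
  rintro f Z ⟨hZ, ⟨V, hV, hVZ⟩, hw⟩
  let Z' : M.Acceptable := ⟨Z, f, hZ⟩
  obtain ⟨i, hi⟩ := hO.2 (.inr Z')
  -- The column of agent `i` has entry zero in row `i`, too small for the ordinal condition. Being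
  -- outside `B`, it gives slack zero, so `i` is full matched.
  have hnot : Sum.inl i ∉ B := fun h => by
    have := hi _ h
    rw [hC.diag] at this
    exact absurd this (not_le.2 (hC.pos _ _ (by simp)))
  have hfull : π.FullMatched (fun Y => b (.inr Y)) i := by
    have := hrow i
    rwa [hbas.2 _ hnot, zero_add] at this
  -- The full matched agent `i` takes part in some `Y` with a positive share. If `Z` did not involve
  -- `i`, its entry in row `i` would exceed that of the basis column `Y`.
  have hiZ : i ∈ M.agents Z := by
    by_contra hiZ
    have hex : ∃ Y ∈ Finset.univ, 0 < b (.inr Y) * π.rate Y i :=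
      Finset.exists_lt_of_sum_lt (by
        rw [Finset.sum_const_zero, show ∑ Y, b (.inr Y) * π.rate Y i = _ from hfull]
        exact π.cap_pos i)
    obtain ⟨Y, -, hY⟩ := hex
    have hbY : 0 < b (.inr Y) := lt_of_le_of_ne (hb _) fun h => by
      rw [← h, zero_mul] at hY
      exact lt_irrefl _ hY
    have hiY : i ∈ M.agents Y.1 := by
      by_contra h
      rw [π.rate_zero Y i h, mul_zero] at hY
      exact lt_irrefl _ hY
    exact absurd (hi _ (hmem _ hbY)) (not_le.2 (hC.large_assignment i i Y Z' hiZ hiY))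
  rcases i with g | w
  · rw [mem_agents_inl, hZ.firms_eq, Finset.mem_singleton] at hiZ
    subst hiZ
    rcases hV with ⟨-, ⟨Y, rfl, hY, hpos⟩, -⟩ | ⟨h, -⟩
    · exact absurd (hi _ (hmem _ hpos)) (not_le.2 (hC.firm g Z' Y hZ hY hVZ))
    · exact h hfull
  · rw [mem_agents_inr] at hiZ
    obtain ⟨V, hV, hVZ⟩ := hw w hiZ
    rcases hV with ⟨-, ⟨Y, rfl, hY, hpos⟩, -⟩ | ⟨h, -⟩
    · exact absurd (hi _ (hmem _ hpos)) (not_le.2 (hC.worker w Z' Y hiZ hY hVZ))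
    · exact h hfull

/-- Step 0 of Scarf's algorithm when there are acceptable assignments. -/
lemma IsUtilityMatrix.scarfInit_eq (hC : M.IsUtilityMatrix C) {Y : M.Acceptable}
    (hY : ∀ Z, C i (.inr Z) ≤ C i (.inr Y)) {S : ScarfState M.Column} :
    ScarfInit C i S ↔ S = .cardinal M.agentColumns
      (insert (.inr Y) (M.agentColumns.erase (.inl i))) (.inr Y) := by
  have hdiff : insert (Sum.inr Y) (M.agentColumns.erase (.inl i)) \ M.agentColumns = {.inr Y} := by
    ext j
    rcases j with j | j <;> simp
  constructor
  · rintro (⟨B, O, j, rfl, hO, hj⟩ | ⟨B, O, rfl, hO, rfl⟩)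
    · rw [hO.unique (hC.isTopColumns_insert i hY), hdiff, Finset.singleton_inj] at hj
      rw [hO.unique (hC.isTopColumns_insert i hY), hj]
    · rw [← hO.unique (hC.isTopColumns_insert i hY), Finset.sdiff_self] at hdiff
      exact absurd hdiff.symm (Finset.singleton_ne_empty _)
  · rintro rfl
    exact .start _ _ _ rfl (hC.isTopColumns_insert i hY) hdiff

lemma scarfInit_eq_of_isEmpty [IsEmpty M.Acceptable] {S : ScarfState M.Column} :
    ScarfInit C i S ↔ S = .terminated M.agentColumns M.agentColumns := by
  have htop := IsUtilityMatrix.isTopColumns_agentColumns C i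
  constructor
  · rintro (⟨B, O, j, rfl, hO, hj⟩ | ⟨B, O, rfl, hO, rfl⟩)
    · rw [hO.unique htop, Finset.sdiff_self] at hj
      exact absurd hj.symm (Finset.singleton_ne_empty _)
    · rfl
  · rintro rfl
    exact .trivial _ _ rfl htop rfl

/-! ### The start is a dead end backwards, and the only one among the live states. -/

section Algorithm

variable (hC : M.IsUtilityMatrix C) (hnd : IsNondegenerate π.matrix π.cap)
  {Y : M.Acceptable} (hY : ∀ Z, C i (.inr Z) ≤ C i (.inr Y))

include hC hY in
lemma isLive_start : (ScarfState.cardinal M.agentColumns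
    (insert (.inr Y) (M.agentColumns.erase (.inl i))) (.inr Y)).IsLive π.matrix π.cap C
      (.inl i) := by
  refine ⟨π.isFeasibleBasis_agentColumns, hC.isOrdinalBasis_insert i hY, ?_, ?_⟩ <;> ext j <;>
    rcases j with j | j <;> simp

include hC in
lemma not_liveStep_rev_start (S : ScarfState M.Column) :
    ¬ ScarfState.LiveStep π.matrix π.cap C (.inl i) (ScarfState.rev (.cardinal M.agentColumns
      (insert (.inr Y) (M.agentColumns.erase (.inl i))) (.inr Y))) S := by
  rintro ⟨-, hl, hs⟩
  cases hs with
  | ordinal_terminate => exact hl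
  | ordinal_continue B O O₁ k j hp hNe =>
    exact hC.not_isOrdinalPivotStep (Finset.erase_insert (by simp)) hp

include hC hnd hY in
/-- The algorithm gets stuck at no live state but the reverse of the first one. -/
lemma exists_scarfStep {S : ScarfState M.Column} (hS : S.IsLive π.matrix π.cap C (.inl i))
    (hne : S ≠ ScarfState.rev (.cardinal M.agentColumns
      (insert (.inr Y) (M.agentColumns.erase (.inl i))) (.inr Y))) :
    ∃ S', ScarfStep π.matrix π.cap C S S' := by
  cases S with
  | terminated B O => exact hS.elim
  | cardinal B O j =>
    have hj : j ∈ O \ B := by rw [hS.2.2.2]; simp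
    obtain ⟨k, B₁, h⟩ := exists_pivotStep hnd π.eq_zero_of_nonneg hS.1 (Finset.mem_sdiff.1 hj).2
    by_cases hEq : B₁ = O
    · exact ⟨_, .cardinal_terminate _ _ _ _ _ h hEq⟩
    · exact ⟨_, .cardinal_continue _ _ _ _ _ h hEq⟩
  | ordinal B O k =>
    obtain ⟨hB, hO, he, hk⟩ := hS
    have hkO : k ∈ O \ B := by rw [hk]; simp
    have hiB : Sum.inl i ∈ B \ O := by rw [he]; simp
    rw [Finset.mem_sdiff] at hkO hiB
    have hstep : ∃ j O₁, IsOrdinalPivotStep C O k j O₁ := by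
      by_contra hno
      -- A state without an ordinal step has no assignment left in `O.erase k`. Counting then gives
      -- all agents but `i`, so `O` is the first ordinal basis and `B` consists of the agent
      -- columns.
      have hsub : O.erase k ⊆ M.agentColumns.erase (.inl i) := by
        rintro (a | V) hV
        · have : a ≠ i := fun h => hiB.2 (h ▸ Finset.mem_of_mem_erase hV)
          simpa using this
        · exact absurd (hC.exists_ordinalPivotStep hO hkO.1 hV) hno
      have heq : O.erase k = M.agentColumns.erase (.inl i) :=
        Finset.eq_of_subset_of_card_le hsub (by
          rw [Finset.card_erase_of_mem hkO.1, Finset.card_erase_of_mem (by simp),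
            card_agentColumns, hO.1])
      have htop := hC.isTopColumns_of_isOrdinalBasis hO
        (heq ▸ Finset.erase_subset _ _) hiB.2
      have hOeq := htop.unique (hC.isTopColumns_insert i hY)
      have hBsub : M.agentColumns ⊆ B := by
        intro j hj
        by_cases hji : j = .inl i
        · exact hji ▸ hiB.1
        · have hjO : j ∈ O.erase k := heq ▸ Finset.mem_erase.2 ⟨hji, hj⟩
          by_contra hjB
          have : j ∈ O \ B := Finset.mem_sdiff.2 ⟨Finset.mem_of_mem_erase hjO, hjB⟩
          rw [hk, Finset.mem_singleton] at this
          exact (Finset.mem_erase.1 hjO).1 this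
      have hBeq : B = M.agentColumns := (Finset.eq_of_subset_of_card_le hBsub (by
        rw [hB.1.1, card_agentColumns])).symm
      have hkY : k = .inr Y := by
        have : (Sum.inr Y : M.Column) ∈ O \ B := by rw [hOeq, hBeq]; simp
        rw [hk, Finset.mem_singleton] at this
        exact this.symm
      exact hne (by rw [hBeq, hOeq, hkY]; rfl)
    obtain ⟨j, O₁, h⟩ := hstep
    by_cases hEq : O₁ = B
    · exact ⟨_, .ordinal_terminate _ _ _ _ _ h hEq⟩
    · exact ⟨_, .ordinal_continue _ _ _ _ _ h hEq⟩

end Algorithm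

lemma exists_stable_of_basis (hC : M.IsUtilityMatrix C)
    (hB : IsFeasibleBasis π.matrix π.cap B) (hO : IsOrdinalBasis C B) :
    ∃ b, IsBasicSolution π.matrix π.cap B b ∧ (∀ j, 0 ≤ b j) ∧
      (∀ b', IsBasicSolution π.matrix π.cap B b' → b' = b) ∧
      π.IsStableScheduleMatching fun Y => b (Sum.inr Y) :=
  let ⟨hbas, b, hb, hb0⟩ := hB
  ⟨b, hb, hb0, fun _ hb' => hbas.basicSolution_unique hb' hb, isStable_of_basis hC hO hb hb0⟩

end Market

theorem theorem3 {F W X : Type*} [Fintype F] [DecidableEq F] [Fintype W] [DecidableEq W]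
    [Fintype X] [DecidableEq X] (hF : 2 ≤ Fintype.card F) (hW : 2 ≤ Fintype.card W)
    (M : Market F W X) (π : M.Scheme) (hnd : IsNondegenerate π.matrix π.cap)
    (C : Matrix (F ⊕ W) M.Column ℝ) (hC : M.IsUtilityMatrix C) (i : F ⊕ W) :
    -- Step 0 can be carried out in exactly one way once the row `i` is chosen
    (∃! S₀, ScarfInit C i S₀) ∧
    ∀ S₀, ScarfInit C i S₀ →
      -- the algorithm maintains a feasible basis and an ordinal basis, and as long as it has not
      -- terminated the next operation can be carried out in exactly one way
      (∀ S, Relation.ReflTransGen (ScarfStep π.matrix π.cap C) S₀ S →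
        IsFeasibleBasis π.matrix π.cap S.basisA ∧ IsOrdinalBasis C S.basisC ∧
        (¬ S.IsTerminated → ∃! S', ScarfStep π.matrix π.cap C S S')) ∧
      -- it never cycles: no pair of bases occurs twice
      (∀ S S', Relation.ReflTransGen (ScarfStep π.matrix π.cap C) S₀ S →
        Relation.TransGen (ScarfStep π.matrix π.cap C) S S' →
        (S.basisA, S.basisC) ≠ (S'.basisA, S'.basisC)) ∧
      -- it terminates: there is no infinite run, and a terminated state is reached
      (¬ ∃ run : ℕ → ScarfState M.Column, run 0 = S₀ ∧
        ∀ s, ScarfStep π.matrix π.cap C (run s) (run (s + 1))) ∧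
      (∃ B O, Relation.ReflTransGen (ScarfStep π.matrix π.cap C) S₀ (.terminated B O)) ∧
      -- at termination the two bases are the same feasible and ordinal basis, whose basic
      -- solution yields a stable `π`-schedule matching
      (∀ B O, Relation.ReflTransGen (ScarfStep π.matrix π.cap C) S₀ (.terminated B O) →
        B = O ∧ IsFeasibleBasis π.matrix π.cap B ∧ IsOrdinalBasis C B ∧
        ∃ b, IsBasicSolution π.matrix π.cap B b ∧ (∀ j, 0 ≤ b j) ∧
          (∀ b', IsBasicSolution π.matrix π.cap B b' → b' = b) ∧
          π.IsStableScheduleMatching fun Y => b (Sum.inr Y)) := by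
  rcases isEmpty_or_nonempty M.Acceptable with hE | hE
  · have hO := hC.isOrdinalBasis_agentColumns
    have hB := π.isFeasibleBasis_agentColumns
    refine ⟨⟨_, Market.scarfInit_eq_of_isEmpty.2 rfl, fun _ => Market.scarfInit_eq_of_isEmpty.1⟩,
      fun S₀ hS₀ => ?_⟩
    obtain rfl := Market.scarfInit_eq_of_isEmpty.1 hS₀
    have hreach : ∀ S, Relation.ReflTransGen (ScarfStep π.matrix π.cap C)
        (.terminated M.agentColumns M.agentColumns) S →
        S = .terminated M.agentColumns M.agentColumns := fun S h => by
      rcases Relation.ReflTransGen.cases_head h with rfl | ⟨c, hc, -⟩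
      · rfl
      · exact absurd hc ScarfState.not_scarfStep_terminated
    refine ⟨fun S h => ?_, fun S S' h h' => ?_, ?_, ⟨_, _, .refl⟩, fun B O h => ?_⟩
    · rw [hreach S h]
      exact ⟨hB, hO, fun hT => (hT trivial).elim⟩
    · rw [hreach S h] at h'
      obtain ⟨c, hc, -⟩ := Relation.TransGen.head'_iff.1 h'
      exact absurd hc ScarfState.not_scarfStep_terminated
    · rintro ⟨run, h0, hrun⟩
      have := hrun 0
      rw [h0] at this
      exact ScarfState.not_scarfStep_terminated this
    · have := hreach _ h
      rw [ScarfState.terminated.injEq] at this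
      obtain ⟨rfl, rfl⟩ := this
      exact ⟨rfl, hB, hO, Market.exists_stable_of_basis hC hB hO⟩
  · obtain ⟨Y, hY⟩ := Finite.exists_max fun Y : M.Acceptable => C i (.inr Y)
    have hrow := hC.row_injective
    refine ⟨⟨_, (hC.scarfInit_eq hY).2 rfl, fun _ => (hC.scarfInit_eq hY).1⟩, fun S₀ hS₀ => ?_⟩
    obtain rfl := (hC.scarfInit_eq hY).1 hS₀
    have hlive := Market.isLive_start (π := π) hC hY
    have hstart := Market.not_liveStep_rev_start (π := π) (i := i) (Y := Y) hC
    have hprog : ∀ S, Relation.ReflTransGen (ScarfStep π.matrix π.cap C) _ S → ¬ S.IsTerminated →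
        ∃ S', ScarfStep π.matrix π.cap C S S' := fun S h hT => by
      rcases hlive.reach h with ⟨hl, hr⟩ | ⟨B, rfl, -⟩
      -- The only live state that could be stuck is the reverse of the start, which the run never
      -- reaches.
      · refine Market.exists_scarfStep hC hnd hY hl fun hS => ?_
        rw [hS] at hr
        exact ScarfState.not_reach_rev hnd hrow hr hlive
      · exact (hT trivial).elim
    refine ⟨fun S h => ⟨?_, ?_, fun hT => ?_⟩, fun S S' h h' => hlive.bases_ne hnd hrow hstart h h',
      hlive.no_infinite_run hnd hrow hstart, hlive.exists_terminated hnd hrow hstart hprog,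
      fun B O h => ?_⟩
    · rcases hlive.reach h with ⟨hl, -⟩ | ⟨B, rfl, hB, -⟩
      exacts [hl.feasible, hB]
    · rcases hlive.reach h with ⟨hl, -⟩ | ⟨B, rfl, -, hO⟩
      exacts [hl.ordinal, hO]
    · obtain ⟨S', hS'⟩ := hprog S h hT
      exact ⟨S', hS', fun S'' h'' => h''.deterministic hnd hrow hS'⟩
    · rcases hlive.reach h with ⟨hl, -⟩ | ⟨B', hE', hB, hO⟩
      · exact hl.elim
      · rw [ScarfState.terminated.injEq] at hE'
        obtain ⟨rfl, rfl⟩ := hE'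
        exact ⟨rfl, hB, hO, Market.exists_stable_of_basis hC hB hO⟩
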